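/- Let $G=(V,E)$ be a finite multigraph on $n$ vertices, possibly with self-loops, of multiplicity $q\ge 1$ (the multiplicity of $G$ is the largest number of pairwise parallel edges, i.e. of edges with the same pair of endpoints). Vertices are agents and edges are goods. Each agent $i$ has an additive utility function $u_i(S)=\sum_{e\in S}u_i(e)$ with $u_i(e)\ge 0$, and $u_i(e)=0$ if $e$ is not incident to $i$. Suppose that the instance is symmetric and bi-valued: there are reals $\alpha>\beta\ge 0$ such that every edge $e$ has a weight $w(e)\in\{\alpha,\beta\}$ with $u_i(e)=w(e)$ for every endpoint $i$ of $e$. Call edges of weight $\alpha$ heavy and edges of weight $\beta$ light. Then $G$ has a partial EFX$_0$ orientation in which all light edges and all but at most $n-1$ heavy edges are allocated. That is, there are pairwise disjoint sets $\pi_i\subseteq E$ ($i\in V$), where every $e\in\pi_i$ has $i$ as an endpoint, such that 1. $u_i(\pi_i)\ge u_i(\pi_j\setminus\{e\})$ for all agents $i\ne j$ and all $e\in\pi_j$; 2. every edge of $E\setminus\bigcup_i\pi_i$ is heavy, and $\bigl|E\setminus\bigcup_i\pi_i\bigr|\le n-1$. -/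

import Mathlib

namespace FairDivision

/-- Two edges of a multigraph are parallel if they have the same pair of endpoints. -/
def Parallel {V E : Type*} (G : Graph V E) (e f : E) : Prop :=
  ∃ x y, G.IsLink e x y ∧ G.IsLink f x y

/-- The multiplicity of an edge: the number of edges parallel to it (including itself). -/
noncomputable def edgeMultiplicity {V E : Type*} (G : Graph V E) (e : E) : ℕ :=
  {f | Parallel G e f}.ncard

/-- The multiplicity of a (finite) multigraph: the maximum multiplicity of one of its edges. -/
noncomputable def multiplicity {V E : Type*} (G : Graph V E) : ℕ :=
  sSup (edgeMultiplicity G '' G.edgeSet)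

/-- A graphical instance of goods with additive utilities: a finite multigraph, possibly with
self-loops, whose vertices are the agents and whose edges are the items. `util i e` is the utility
of the single item `e` to agent `i`; it is nonnegative, and zero unless `i` is an endpoint of `e`. -/
structure GoodsInstance (V E : Type*) where
  graph : Graph V E
  finite_vertexSet : graph.vertexSet.Finite
  finite_edgeSet : graph.edgeSet.Finite
  util : V → E → ℝ
  util_nonneg : ∀ i e, 0 ≤ util i e
  util_eq_zero : ∀ i e, ¬ graph.Inc e i → util i e = 0

namespace GoodsInstance

variable {V E : Type*}

/-- The additive utility of a set of items to agent `i`. -/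
def bundleUtil (I : GoodsInstance V E) (i : V) (S : Finset E) : ℝ :=
  ∑ e ∈ S, I.util i e

/-- Both endpoints of every edge agree on its utility (the weight of the edge). -/
def IsSymmetric (I : GoodsInstance V E) : Prop :=
  ∀ e i j, I.graph.IsLink e i j → I.util i e = I.util j e

/-- Every edge has utility `a` or `b` to each of its endpoints, where `a > b ≥ 0`. -/
def IsBivalued (I : GoodsInstance V E) (a b : ℝ) : Prop :=
  b < a ∧ 0 ≤ b ∧ ∀ e i, I.graph.Inc e i → I.util i e = a ∨ I.util i e = b

/-- The edges of weight `a`. With `a` the larger of the two weights of a symmetric bi-valued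
instance these are the heavy edges. -/
def heavyEdges (I : GoodsInstance V E) (a : ℝ) : Set E :=
  {e | ∃ i, I.graph.Inc e i ∧ I.util i e = a}

/-- A (possibly partial) orientation: pairwise disjoint bundles of edges, one for every vertex,
such that every allocated edge is allocated to one of its endpoints. -/
structure IsPartialOrientation (I : GoodsInstance V E) (π : V → Finset E) : Prop where
  disjoint : ∀ i j, i ≠ j → Disjoint (π i) (π j)
  inc : ∀ i, ∀ e ∈ π i, I.graph.Inc e i

/-- Envy-freeness up to any good: for any two agents `i`, `j` and any item `e` in the bundle of `j`,
agent `i` does not envy `j` after `e` is removed from the bundle of `j`. -/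
def IsEFX0 [DecidableEq E] (I : GoodsInstance V E) (π : V → Finset E) : Prop :=
  ∀ i ∈ I.graph.vertexSet, ∀ j ∈ I.graph.vertexSet, i ≠ j → ∀ e ∈ π j,
    I.bundleUtil i ((π j).erase e) ≤ I.bundleUtil i (π i)

/-- The edges that are in nobody's bundle. -/
def unallocated (I : GoodsInstance V E) (π : V → Finset E) : Set E :=
  {e ∈ I.graph.edgeSet | ∀ i, e ∉ π i}

end GoodsInstance

end FairDivision

/-! Parallel edges of equal weight are paired and split between their endpoints, so paired edges
cause no envy, and each pair of vertices keeps at most one heavy and one light single edge. Among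
the single heavy edges, deleting the neighbourhood of a vertex set of maximal Hall deficiency lets
every vertex of the remaining set `A` own a heavy edge, while all surviving single heavy edges lie
inside `A`. A single light edge parallel to a surviving heavy one goes to the other endpoint. So `i`
values the bundle of `j` at its own share `s` of the pairs between them plus at most one edge.

That edge is harmless if `i` is in `A`, or if it is light and `i` owns anything else. In the
remaining case the light orientation, which minimizes a weight on vertices without incoming light
edges, forces every edge owned by `j` to join `i` and `j`. Removing any of them then removes the
excess. -/

namespace FairDivision

/-! ### Even splitting of parallel edges -/

open Finset in
/-- Parallel edges of equal weight can be paired up and split evenly between their endpoints. The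
set `B` consists of the loops and of the edges that are paired up. -/
theorem exists_balanced_split {V E W : Type*} [DecidableEq V] [DecidableEq E]
    (ends : E → Sym2 V) (w : E → W) (F : Finset E) :
    ∃ B ⊆ F, ∃ own : E → V, (∀ e ∈ B, own e ∈ ends e) ∧ (∀ e ∈ F, (ends e).IsDiag → e ∈ B) ∧
      (∀ e ∈ F \ B, ∀ f ∈ F \ B, ends e = ends f → w e = w f → e = f) ∧
      ∀ x y, x ≠ y → ∀ g : W → ℝ,
        ∑ e ∈ B with ends e = s(x, y) ∧ own e = x, g (w e) =
          ∑ e ∈ B with ends e = s(x, y) ∧ own e = y, g (w e) := by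
  induction F using Finset.strongInduction with
  | H F ih =>
    by_cases hinj : ∀ e ∈ F, ∀ f ∈ F, ¬ (ends e).IsDiag → ends e = ends f → w e = w f → e = f
    · classical
      refine ⟨F.filter fun e => (ends e).IsDiag, filter_subset _ _, fun e => (ends e).out.1,
        fun e _ => Sym2.out_fst_mem _, fun e he hd => mem_filter.2 ⟨he, hd⟩, ?_, ?_⟩
      · intro e he f hf h1 h2
        simp only [mem_sdiff, mem_filter, not_and] at he hf
        exact hinj e he.1 f hf.1 (he.2 he.1) h1 h2
      · intro x y hxy g
        have key : ∀ z, (F.filter fun e => (ends e).IsDiag).filter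
            (fun e => ends e = s(x, y) ∧ (ends e).out.1 = z) = ∅ := by
          intro z
          refine filter_eq_empty_iff.2 fun e he h => ?_
          have := (mem_filter.1 he).2
          rw [h.1] at this
          exact hxy (Sym2.mk_isDiag_iff.1 this)
        rw [key, key]
    · push Not at hinj
      obtain ⟨e, he, f, hf, hd, hef, hw, hne⟩ := hinj
      obtain ⟨p, q, hpq⟩ : ∃ p q, ends e = s(p, q) := (ends e).ind fun p q => ⟨p, q, rfl⟩
      have hpq' : p ≠ q := fun h => hd (by rw [hpq]; exact Sym2.mk_isDiag_iff.2 h)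
      obtain ⟨B, hB, own, hown, hdiag, hinj, hbal⟩ := ih ((F.erase e).erase f)
        ((erase_subset _ _).trans_ssubset (erase_ssubset he))
      have heB : e ∉ B := fun h => by simpa using hB h
      have hfB : f ∉ B := fun h => by simpa using hB h
      have hown' : ∀ d ∈ B, Function.update (Function.update own e p) f q d = own d := by
        intro d hdB
        rw [Function.update_of_ne (ne_of_mem_of_not_mem hdB hfB),
          Function.update_of_ne (ne_of_mem_of_not_mem hdB heB)]
      have hoe : Function.update (Function.update own e p) f q e = p := by
        rw [Function.update_of_ne hne, Function.update_self]
      have hof : Function.update (Function.update own e p) f q f = q := Function.update_self ..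
      refine ⟨insert e (insert f B), ?_, Function.update (Function.update own e p) f q,
        ?_, ?_, ?_, ?_⟩
      · refine insert_subset he (insert_subset hf (hB.trans ?_))
        exact (erase_subset _ _).trans (erase_subset _ _)
      · intro d hdm
        simp only [mem_insert] at hdm
        rcases hdm with rfl | rfl | hdB
        · rw [hoe, hpq]; simp
        · rw [hof, ← hef, hpq]; simp
        · rw [hown' d hdB]; exact hown d hdB
      · intro d hdF hdd
        by_cases h1 : d = e
        · simp [h1]
        by_cases h2 : d = f
        · simp [h2]
        have := hdiag d (by simp [h1, h2, hdF]) hdd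
        simp [this]
      · intro d hdm d' hdm'
        simp only [mem_sdiff, mem_insert, not_or] at hdm hdm'
        exact hinj d (by simp [hdm]) d' (by simp [hdm'])
      · intro x y hxy g
        have key : ∀ z, ∑ d ∈ insert e (insert f B) with ends d = s(x, y) ∧
              Function.update (Function.update own e p) f q d = z, g (w d) =
            (if s(p, q) = s(x, y) ∧ p = z then g (w e) else 0) +
            ((if s(p, q) = s(x, y) ∧ q = z then g (w e) else 0) +
            ∑ d ∈ B with ends d = s(x, y) ∧ own d = z, g (w d)) := by
          intro z
          rw [sum_filter, sum_insert (by simp [hne, heB]), sum_insert hfB, hoe, hof, ← hef, hpq,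
            ← hw, sum_filter]
          congr 2
          refine sum_congr rfl fun d hdB => ?_
          rw [hown' d hdB]
        rw [key, key, hbal x y hxy g, ← add_assoc, ← add_assoc]
        congr 1
        by_cases h : s(p, q) = s(x, y)
        · rcases Sym2.eq_iff.1 h with ⟨rfl, rfl⟩ | ⟨rfl, rfl⟩
          · simp [hpq', hpq'.symm]
          · simp [hpq', hpq'.symm, h]
        · simp [h]

/-! ### Heavy edges: Hall deficiency -/

open Finset in
/-- After the removal of fewer than `#U` edges, the remaining edges live on a vertex set `A` and can
be oriented in such a way that every vertex of `A` has positive indegree. -/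
theorem exists_removal_orientation {V E : Type*} [DecidableEq V] [DecidableEq E]
    (ends : E → Sym2 V) (U : Finset V) (hU : U.Nonempty) (H : Finset E)
    (hH : ∀ e ∈ H, ∀ v ∈ ends e, v ∈ U) :
    ∃ X ⊆ H, ∃ (A : Finset V) (own : E → V), #X + 1 ≤ #U ∧
      (∀ e ∈ H \ X, ∀ v ∈ ends e, v ∈ A) ∧ (∀ e, own e ∈ ends e) ∧
      ∀ v ∈ A, ∃ e ∈ H \ X, own e = v := by
  classical
  let N : Finset V → Finset E := fun S => H.filter fun e => ∃ v ∈ S, v ∈ ends e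
  -- `S` has maximal deficiency, and `N S` will be the removed set.
  obtain ⟨S, hSU, hcard, hmax⟩ : ∃ S ⊆ U, #(N S) + 1 ≤ #U ∧
      ∀ T ⊆ U, (#T : ℤ) - #(N T) ≤ #S - #(N S) := by
    obtain ⟨S, hS, hmax⟩ := exists_max_image U.powerset (fun S => (#S : ℤ) - #(N S))
      ⟨∅, by simp⟩
    rw [mem_powerset] at hS
    have hN : N ∅ = ∅ := by simp [N]
    have hmax' : ∀ T ⊆ U, (#T : ℤ) - #(N T) ≤ #S - #(N S) :=
      fun T hT => hmax T (mem_powerset.2 hT)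
    have h0 := hmax' ∅ (empty_subset _)
    have hle := card_le_card hS
    have hpos := hU.card_pos
    rw [hN] at h0
    by_cases hlt : #(N S) < #S
    · exact ⟨S, hS, by omega, hmax'⟩
    -- The maximal deficiency is zero here, so `∅` attains it too and nothing is removed.
    · refine ⟨∅, empty_subset _, by rw [hN]; simpa using hpos, fun T hT => ?_⟩
      have := hmax' T hT
      rw [hN]
      simp only [card_empty] at h0 ⊢
      omega
  let t : {v // v ∈ U \ S} → Finset E := fun v => (H \ N S).filter fun e => v.1 ∈ ends e
  -- A violation of Hall's condition by `T` would give `S ∪ T` a larger deficiency than `S`.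
  obtain ⟨f, hf, hft⟩ := (all_card_le_biUnion_card_iff_exists_injective t).1 <| by
    intro T
    have hTU : T.map (Function.Embedding.subtype _) ⊆ U \ S := by
      intro v hv
      obtain ⟨x, -, rfl⟩ := mem_map.1 hv
      exact x.2
    have h1 := hmax (S ∪ T.map (Function.Embedding.subtype _))
      (union_subset hSU (hTU.trans sdiff_subset))
    have h2 : N (S ∪ T.map (Function.Embedding.subtype _)) ⊆ N S ∪ T.biUnion t := by
      intro e he
      obtain ⟨heH, v, hv, hve⟩ := mem_filter.1 he
      by_cases heS : e ∈ N S
      · exact mem_union_left _ heS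
      refine mem_union_right _ ?_
      rcases mem_union.1 hv with hv | hv
      · exact absurd (mem_filter.2 ⟨heH, v, hv, hve⟩) heS
      · obtain ⟨x, hx, rfl⟩ := mem_map.1 hv
        exact mem_biUnion.2 ⟨x, hx, mem_filter.2 ⟨mem_sdiff.2 ⟨heH, heS⟩, hve⟩⟩
    have h3 := (card_le_card h2).trans (card_union_le _ _)
    rw [card_union_of_disjoint (disjoint_sdiff.mono_right hTU), card_map] at h1
    omega
  refine ⟨N S, filter_subset _ _, U \ S,
    fun e => if h : ∃ v, f v = e then h.choose.1 else (ends e).out.1, hcard, ?_, ?_, ?_⟩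
  · intro e he v hv
    obtain ⟨heH, heS⟩ := mem_sdiff.1 he
    exact mem_sdiff.2 ⟨hH e heH v hv, fun hvS => heS (mem_filter.2 ⟨heH, v, hvS, hv⟩)⟩
  · intro e
    by_cases h : ∃ v, f v = e
    · simp only [h, dif_pos]
      have := (mem_filter.1 (hft h.choose)).2
      rwa [h.choose_spec] at this
    · simp only [h, dif_neg, not_false_eq_true]
      exact Sym2.out_fst_mem _
  · intro v hv
    refine ⟨f ⟨v, hv⟩, (mem_filter.1 (hft _)).1, ?_⟩
    have h : ∃ v', f v' = f ⟨v, hv⟩ := ⟨_, rfl⟩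
    simp only [dif_pos h, hf h.choose_spec]

/-! ### Light edges: a weight-minimal orientation -/

open Finset in
/-- An orientation that minimizes the total weight of the vertices of indegree zero: the
out-neighbours of a vertex of positive weight and indegree zero have indegree one and weigh at least
as much. -/
theorem exists_orientation_of_weight {V E : Type*} [DecidableEq V]
    (ends : E → Sym2 V) (U : Finset V) (L : Finset E) (hL : ∀ e ∈ L, ∀ v ∈ ends e, v ∈ U)
    (wt : V → ℕ) :
    ∃ own : E → V, (∀ e, own e ∈ ends e) ∧
      ∀ v, 0 < wt v → (∀ e ∈ L, own e ≠ v) → ∀ e ∈ L, v ∈ ends e →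
        wt v ≤ wt (own e) ∧ ∀ e' ∈ L, own e' = own e → e' = e := by
  classical
  let φ : (E → V) → V → ℕ := fun own x => if ∃ e ∈ L, own e = x then 0 else wt x
  obtain ⟨own, hown, hmin⟩ : ∃ own : E → V, (∀ e, own e ∈ ends e) ∧
      ∀ own' : E → V, (∀ e, own' e ∈ ends e) → ∑ x ∈ U, φ own x ≤ ∑ x ∈ U, φ own' x := by
    have := WellFounded.has_min (InvImage.wf (fun own : E → V => ∑ x ∈ U, φ own x) Nat.lt_wfRel.wf)
      {own | ∀ e, own e ∈ ends e} ⟨fun e => (ends e).out.1, fun e => Sym2.out_fst_mem _⟩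
    obtain ⟨own, h, hmin⟩ := this
    exact ⟨own, h, fun own' h' => not_lt.1 (hmin own' h')⟩
  refine ⟨own, hown, fun v hv hv0 e he hve => ?_⟩
  have hne : own e ≠ v := hv0 e he
  have hown' : ∀ d, Function.update own e v d ∈ ends d := by
    intro d
    by_cases h : d = e
    · subst h; simpa using hve
    · rw [Function.update_of_ne h]; exact hown d
  -- Redirecting `e` to `v` saves `wt v`. Only the old owner can lose its last incoming edge, so
  -- minimality forces it to do so at a cost of at least `wt v`.
  have hle := hmin _ hown'
  have hvU := hL e he v hve
  have hdU : own e ∈ U.erase v := mem_erase.2 ⟨hne, hL e he _ (hown e)⟩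
  rw [← add_sum_erase _ _ hvU, ← add_sum_erase _ _ hvU, ← add_sum_erase _ _ hdU,
    ← add_sum_erase _ _ hdU] at hle
  have hrest : ∑ x ∈ (U.erase v).erase (own e), φ own x =
      ∑ x ∈ (U.erase v).erase (own e), φ (Function.update own e v) x := by
    refine sum_congr rfl fun x hx => ?_
    obtain ⟨hx1, hx2⟩ := mem_erase.1 hx
    have hx3 := (mem_erase.1 hx2).1
    have : (∃ d ∈ L, own d = x) ↔ ∃ d ∈ L, Function.update own e v d = x := by
      refine exists_congr fun d => and_congr_right fun _ => ?_
      by_cases h : d = e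
      · subst h; simp [hx1.symm, hx3.symm]
      · rw [Function.update_of_ne h]
    simp only [φ, this]
  have h1 : φ own v = wt v := if_neg (by push Not; exact hv0)
  have h2 : φ (Function.update own e v) v = 0 := if_pos ⟨e, he, by simp⟩
  have h3 : φ own (own e) = 0 := if_pos ⟨e, he, rfl⟩
  have hkey : wt v ≤ φ (Function.update own e v) (own e) := by omega
  have huniq : ∀ e' ∈ L, own e' = own e → e' = e := by
    intro e' he' heq
    by_contra hcon
    have : φ (Function.update own e v) (own e) = 0 :=
      if_pos ⟨e', he', by rw [Function.update_of_ne hcon, heq]⟩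
    omega
  refine ⟨hkey.trans ?_, huniq⟩
  simp only [φ]
  split_ifs <;> omega

/-! ### Combining the orientations and checking EFX -/

open Finset in
/-- The orientation result in terms of finite sets of edges, with `F \ K` the unallocated edges. -/
theorem exists_efx_allocation {V E : Type*} [DecidableEq V] [DecidableEq E]
    (ends : E → Sym2 V) (U : Finset V) (hU : U.Nonempty) (F : Finset E)
    (hF : ∀ e ∈ F, ∀ v ∈ ends e, v ∈ U) (w : E → ℝ) (a b : ℝ) (hba : b < a) (hb : 0 ≤ b)
    (hw : ∀ e ∈ F, w e = a ∨ w e = b) :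
    ∃ K ⊆ F, ∃ own : E → V, (∀ e ∈ K, own e ∈ ends e) ∧ (∀ e ∈ F \ K, w e = a) ∧
      #(F \ K) + 1 ≤ #U ∧ ∀ i j, i ≠ j → ∀ e ∈ K, own e = j →
        ∑ f ∈ (K.filter (own · = j)).erase e, (if i ∈ ends f then w f else 0) ≤
          ∑ f ∈ K with own f = i, w f := by
  classical
  obtain ⟨B, hBF, oB, hoB, hdiag, hinj, hbal⟩ := exists_balanced_split ends w F
  obtain ⟨X, hXH, A, oH, hXcard, hHA, hoH, hAH⟩ :=
    exists_removal_orientation ends U hU ((F \ B).filter (w · = a))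
      (fun e he => hF e (mem_sdiff.1 (mem_filter.1 he).1).1)
  have hHmem : ∀ e, e ∈ (F \ B).filter (w · = a) \ X ↔ e ∈ F \ X ∧ e ∉ B ∧ w e = a := by
    intro e; simp only [mem_sdiff, mem_filter]; tauto
  simp only [hHmem] at hHA hAH
  -- Such a vertex needs no light edge: whichever neighbour it looks at, it owns something besides
  -- the shared pairs with that neighbour.
  let Suff : V → Prop := fun v => v ∈ A ∨ ∀ c, ∃ e ∈ B, oB e = v ∧ ends e ≠ s(v, c)
  let wt : V → ℕ := fun v => if Suff v then 0 else if ∃ e ∈ B, oB e = v then 1 else 2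
  obtain ⟨oL, hoL, hLwt⟩ := exists_orientation_of_weight ends U ((F \ B).filter (w · = b))
    (fun e he => hF e (mem_sdiff.1 (mem_filter.1 he).1).1) wt
  have hnd : ∀ e ∈ F, e ∉ B → ¬ (ends e).IsDiag := fun e he heB hd => heB (hdiag e he hd)
  have hXB : ∀ e ∈ X, e ∉ B ∧ w e = a := fun e he => by
    have := mem_filter.1 (hXH he)
    exact ⟨(mem_sdiff.1 this.1).2, this.2⟩
  have hXF : X ⊆ F := fun e he => (mem_sdiff.1 (mem_filter.1 (hXH he)).1).1
  obtain ⟨own, hown, hownB, hownH, hopp, hownL⟩ : ∃ own : E → V, (∀ e ∈ F, own e ∈ ends e) ∧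
      (∀ e ∈ B, own e = oB e) ∧ (∀ e, e ∉ B → w e = a → own e = oH e) ∧
      (∀ e ∈ F, e ∉ B → w e = b → ∀ h ∈ F \ X, h ∉ B → w h = a → ends h = ends e →
        own e ≠ oH h) ∧
      (∀ e, e ∉ B → w e = b → ∀ v ∈ ends e, v ∉ A → own e = oL e) := by
    have hother : ∀ e, ∃ v, v ∈ ends e ∧
        (e ∈ F → e ∉ B → ∀ h ∈ F \ X, h ∉ B → w h = a → ends h = ends e → v ≠ oH h) ∧
        (∀ x ∈ ends e, x ∉ A → v = oL e) := by
      intro e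
      -- A surviving parallel heavy edge puts both endpoints in `A`, so overriding `oL` here never
      -- affects a light edge with an endpoint outside `A`.
      by_cases hh : ∃ h ∈ F \ X, h ∉ B ∧ w h = a ∧ ends h = ends e
      · obtain ⟨h, hhX, hhB, hha, hhe⟩ := hh
        have hmem : oH h ∈ ends e := hhe ▸ hoH h
        refine ⟨Sym2.Mem.other hmem, Sym2.other_mem hmem, ?_, ?_⟩
        · intro heF heB h' h1 h2 h3 h4
          have : h' = h := hinj h' (mem_sdiff.2 ⟨(mem_sdiff.1 h1).1, h2⟩) h
            (mem_sdiff.2 ⟨(mem_sdiff.1 hhX).1, hhB⟩) (h4.trans hhe.symm) (h3.trans hha.symm)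
          subst this
          exact Sym2.other_ne (hnd e heF heB) hmem
        · intro x hx hxA
          exact absurd (hHA h ⟨hhX, hhB, hha⟩ x (hhe ▸ hx)) hxA
      · refine ⟨oL e, hoL e, ?_, fun _ _ _ => rfl⟩
        intro _ _ h h1 h2 h3 h4
        exact absurd ⟨h, h1, h2, h3, h4⟩ hh
    choose oL' h1 h2 h3 using hother
    refine ⟨fun e => if e ∈ B then oB e else if w e = a then oH e else oL' e, ?_, ?_, ?_, ?_, ?_⟩
    · intro e _
      dsimp only
      split_ifs with h4 h5
      exacts [hoB e h4, hoH e, h1 e]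
    · intro e he
      simp [he]
    · intro e he hea
      simp [he, hea]
    · intro e heF heB heb
      simpa [heB, heb, hba.ne] using h2 e heF heB
    · intro e heB heb
      simpa [heB, heb, hba.ne] using h3 e
  have hFX : F \ (F \ X) = X := Finset.sdiff_sdiff_eq_self hXF
  refine ⟨F \ X, sdiff_subset, own, fun e he => hown e (mem_sdiff.1 he).1, ?_, ?_, ?_⟩
  · rw [hFX]; exact fun e he => (hXB e he).2
  · rw [hFX]; exact hXcard
  intro i j hij e he hej
  have hwb : ∀ f ∈ F, b ≤ w f := fun f hf => by rcases hw f hf with h | h <;> rw [h]; exact hba.le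
  have hw0 : ∀ f ∈ F, 0 ≤ w f := fun f hf => hb.trans (hwb f hf)
  have hBK : ∀ f ∈ B, f ∈ F \ X := fun f hf => mem_sdiff.2 ⟨hBF hf, fun h => (hXB f h).1 hf⟩
  have heF := (mem_sdiff.1 he).1
  set s := ∑ f ∈ B with ends f = s(i, j) ∧ oB f = i, w f with hs
  -- the bundle of `i`
  have hlow : s ≤ ∑ f ∈ F \ X with own f = i, w f := by
    refine sum_le_sum_of_subset_of_nonneg ?_ fun f hf _ =>
      hw0 f (mem_sdiff.1 (mem_filter.1 hf).1).1
    intro f hf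
    obtain ⟨hfB, -, hfi⟩ := mem_filter.1 hf
    exact mem_filter.2 ⟨hBK f hfB, (hownB f hfB).trans hfi⟩
  have hlow' : ∀ d ∈ F \ X, own d = i → (d ∈ B → ends d ≠ s(i, j)) →
      s + w d ≤ ∑ f ∈ F \ X with own f = i, w f := by
    intro d hd hdi hdB
    rw [hs, add_comm, ← sum_insert (by
      intro h
      obtain ⟨h1, h2, -⟩ := mem_filter.1 h
      exact hdB h1 h2)]
    refine sum_le_sum_of_subset_of_nonneg ?_ fun f hf _ =>
      hw0 f (mem_sdiff.1 (mem_filter.1 hf).1).1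
    intro f hf
    rcases mem_insert.1 hf with rfl | hf
    · exact mem_filter.2 ⟨hd, hdi⟩
    obtain ⟨hfB, -, hfi⟩ := mem_filter.1 hf
    exact mem_filter.2 ⟨hBK f hfB, (hownB f hfB).trans hfi⟩
  -- the bundle of `j`
  have hends : ∀ f ∈ F, own f = j → i ∈ ends f → ends f = s(i, j) := fun f hf hfj hif =>
    (Sym2.mem_and_mem_iff hij).1 ⟨hif, hfj ▸ hown f hf⟩
  set D := (F \ X).filter (fun f => (own f = j ∧ i ∈ ends f) ∧ f ∉ B) with hD
  have hT : ∑ f ∈ F \ X with own f = j, (if i ∈ ends f then w f else 0) = s + ∑ f ∈ D, w f := by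
    rw [← sum_filter, filter_filter,
      ← sum_filter_add_sum_filter_not ((F \ X).filter _) (· ∈ B), filter_filter, filter_filter]
    congr 1
    rw [hs, hbal i j hij (fun x => x)]
    refine sum_congr ?_ fun _ _ => rfl
    ext f
    simp only [mem_filter]
    constructor
    · rintro ⟨hf, ⟨hfj, hif⟩, hfB⟩
      exact ⟨hfB, hends f (hBF hfB) hfj hif, (hownB f hfB).symm.trans hfj⟩
    · rintro ⟨hfB, hfe, hfj⟩
      exact ⟨hBK f hfB, ⟨(hownB f hfB).trans hfj, by rw [hfe]; simp⟩, hfB⟩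
  have hLHS : ∑ f ∈ ((F \ X).filter (own · = j)).erase e, (if i ∈ ends f then w f else 0) =
      s + ∑ f ∈ D, w f - (if i ∈ ends e then w e else 0) := by
    rw [← hT, sum_erase_eq_sub (mem_filter.2 ⟨he, hej⟩)]
  rw [hLHS]
  have hpos : 0 ≤ if i ∈ ends e then w e else 0 := by
    split_ifs
    exacts [hw0 e heF, le_rfl]
  have hDmem : ∀ f ∈ D, f ∈ F \ X ∧ f ∈ F ∧ f ∉ B ∧ own f = j ∧ ends f = s(i, j) := by
    intro f hf
    obtain ⟨h1, ⟨h2, h3⟩, h4⟩ := mem_filter.1 hf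
    have h5 := (mem_sdiff.1 h1).1
    exact ⟨h1, h5, h4, h2, hends f h5 h2 h3⟩
  have hDab : ∀ f ∈ D, ∀ g ∈ D, w f = a → w g = b → False := by
    intro f hf g hg hfa hgb
    obtain ⟨f1, f2, f3, f4, f5⟩ := hDmem f hf
    obtain ⟨g1, g2, g3, g4, g5⟩ := hDmem g hg
    refine hopp g g2 g3 hgb f f1 f3 hfa (f5.trans g5.symm) ?_
    rw [g4, ← hownH f f3 hfa, f4]
  have hDsub : ∀ f ∈ D, ∀ g ∈ D, f = g := by
    intro f hf g hg
    obtain ⟨f1, f2, f3, f4, f5⟩ := hDmem f hf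
    obtain ⟨g1, g2, g3, g4, g5⟩ := hDmem g hg
    refine hinj f (mem_sdiff.2 ⟨f2, f3⟩) g (mem_sdiff.2 ⟨g2, g3⟩) (f5.trans g5.symm) ?_
    rcases hw f f2 with h | h <;> rcases hw g g2 with h' | h'
    · rw [h, h']
    · exact (hDab f hf g hg h h').elim
    · exact (hDab g hg f hf h' h).elim
    · rw [h, h']
  rcases D.eq_empty_or_nonempty with hD0 | ⟨d, hd⟩
  · rw [hD0, sum_empty]; linarith
  have hD1 : D = {d} := eq_singleton_iff_unique_mem.2 ⟨hd, fun f hf => hDsub f hf d hd⟩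
  obtain ⟨d1, d2, d3, d4, d5⟩ := hDmem d hd
  rw [hD1, sum_singleton]
  by_cases hiA : i ∈ A
  · obtain ⟨h, ⟨hhX, hhB, hha⟩, hhi⟩ := hAH i hiA
    have h1 := hlow' h hhX ((hownH h hhB hha).trans hhi) (fun h => absurd h hhB)
    have h2 : w d ≤ a := by rcases hw d d2 with h | h <;> rw [h]; exact hba.le
    linarith
  have hdb : w d = b := by
    refine (hw d d2).resolve_left fun hda => hiA (hHA d ⟨d1, d3, hda⟩ i ?_)
    rw [d5]; simp
  rw [hdb]
  -- anything `i` owns besides the even share of the edges to `j` suffices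
  by_cases hex : ∃ f ∈ F \ X, own f = i ∧ (f ∈ B → ends f ≠ s(i, j))
  · obtain ⟨f, hf, hfi, hfB⟩ := hex
    have h1 := hlow' f hf hfi hfB
    have h2 := hwb f (mem_sdiff.1 hf).1
    linarith
  push Not at hex
  have hBi : ∀ f ∈ B, oB f = i → ends f = s(i, j) := fun f hfB hfi =>
    (hex f (hBK f hfB) ((hownB f hfB).trans hfi)).2
  have hwti : wt i = if ∃ f ∈ B, oB f = i then 1 else 2 := by
    refine if_neg ?_
    rintro (h | h)
    · exact hiA h
    · obtain ⟨f, hfB, hfi, hf⟩ := h j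
      exact hf (hBi f hfB hfi)
  have hLmem : ∀ f, f ∈ (F \ B).filter (w · = b) ↔ f ∈ F \ X ∧ f ∉ B ∧ w f = b := by
    intro f
    simp only [mem_filter, mem_sdiff]
    constructor
    · rintro ⟨⟨h1, h2⟩, h3⟩
      exact ⟨⟨h1, fun h => hba.ne (h3.symm.trans (hXB f h).2)⟩, h2, h3⟩
    · tauto
  simp only [hLmem] at hLwt
  obtain ⟨hwle, huniq⟩ := hLwt i (by rw [hwti]; split_ifs <;> norm_num) (by
    rintro f ⟨hf, hfB, hfb⟩ hfi
    exact hfB (hex f hf (by rw [hownL f hfB hfb i (hfi ▸ hoL f) hiA, hfi])).1) d ⟨d1, d3, hdb⟩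
    (by rw [d5]; simp)
  have hdL : oL d = j := by rw [← hownL d d3 hdb i (by rw [d5]; simp) hiA, d4]
  rw [hdL] at hwle huniq
  -- `wt i` is positive, so `wt j` is too.
  have hSj : ¬ Suff j := by
    intro h
    have : wt j = 0 := if_pos h
    rw [this, hwti] at hwle
    split_ifs at hwle <;> omega
  have hwtj : wt j = if ∃ f ∈ B, oB f = j then 1 else 2 := if_neg hSj
  simp only [Suff, not_or, not_forall, not_exists, not_and, not_not] at hSj
  obtain ⟨hjA, c, hc⟩ := hSj
  have hBj : ∀ f ∈ B, oB f = j → ends f = s(i, j) := by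
    intro f hfB hfj
    rw [hwtj, if_pos ⟨f, hfB, hfj⟩, hwti] at hwle
    have hne : ∃ g ∈ B, oB g = i := by
      by_contra h
      rw [if_neg h] at hwle
      omega
    obtain ⟨g, hgB, hgi⟩ := hne
    -- Counting edges rather than weights, since `b` may be zero.
    have hone := hbal i j hij (fun _ => 1)
    simp only [sum_const, nsmul_eq_mul, mul_one, Nat.cast_inj] at hone
    have hgpos : 0 < #(B.filter fun e => ends e = s(i, j) ∧ oB e = i) :=
      card_pos.2 ⟨g, mem_filter.2 ⟨hgB, hBi g hgB hgi, hgi⟩⟩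
    rw [hone] at hgpos
    obtain ⟨k, hk⟩ := card_pos.1 hgpos
    obtain ⟨hkB, hke, hkj⟩ := mem_filter.1 hk
    rw [hc f hfB hfj, ← hc k hkB hkj, hke]
  -- The removed edge also counts for `i`, at no less than `b`, which cancels the light edge `d`.
  have hie : i ∈ ends e := by
    suffices h : ends e = s(i, j) by rw [h]; simp
    by_cases heB : e ∈ B
    · exact hBj e heB ((hownB e heB).symm.trans hej)
    have hje : j ∈ ends e := hej ▸ hown e heF
    rcases hw e heF with hea | heb
    · exact absurd (hHA e ⟨he, heB, hea⟩ j hje) hjA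
    · rw [huniq e ⟨he, heB, heb⟩ (by rw [← hownL e heB heb j hje hjA, hej]), d5]
  rw [if_pos hie]
  have := hwb e heF
  linarith

end FairDivision

theorem mainTheorem8 {V E : Type*} [DecidableEq E] (I : FairDivision.GoodsInstance V E)
    (hsymm : I.IsSymmetric) (a b : ℝ) (hbi : I.IsBivalued a b)
    (q : ℕ) (hq : 1 ≤ q) (hmult : FairDivision.multiplicity I.graph = q) :
    ∃ π : V → Finset E, I.IsPartialOrientation π ∧ I.IsEFX0 π ∧
      I.unallocated π ⊆ I.heavyEdges a ∧
      (I.unallocated π).ncard + 1 ≤ I.graph.vertexSet.ncard := by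
  classical
  obtain ⟨hba, hb, hval⟩ := hbi
  -- Without edges the multiplicity would be `sSup ∅ = 0`, against `q ≥ 1`. An edge yields a vertex,
  -- which the strict cardinality bound needs.
  have hE : I.graph.edgeSet.Nonempty := by
    by_contra h
    rw [Set.not_nonempty_iff_eq_empty] at h
    simp only [FairDivision.multiplicity, h, Set.image_empty, csSup_empty, bot_eq_zero] at hmult
    omega
  have hlink : ∀ e ∈ I.graph.edgeSet, ∃ x y, I.graph.IsLink e x y :=
    fun e he => I.graph.exists_isLink_of_mem_edgeSet he
  obtain ⟨e₀, he₀⟩ := hE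
  obtain ⟨x₀, y₀, h₀⟩ := hlink e₀ he₀
  have hV : I.graph.vertexSet.Nonempty := ⟨x₀, h₀.left_mem⟩
  have hends : ∃ ends : E → Sym2 V, ∀ e ∈ I.graph.edgeSet, ∀ v, v ∈ ends e ↔ I.graph.Inc e v := by
    refine ⟨fun e => if h : e ∈ I.graph.edgeSet then
      s((hlink e h).choose, (hlink e h).choose_spec.choose) else s(x₀, x₀), fun e he v => ?_⟩
    have := (hlink e he).choose_spec.choose_spec
    simp only [dif_pos he, Sym2.mem_iff]
    refine ⟨?_, fun h => h.eq_or_eq_of_isLink this⟩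
    rintro (rfl | rfl)
    exacts [this.inc_left, this.inc_right]
  obtain ⟨ends, hends⟩ := hends
  let F := I.finite_edgeSet.toFinset
  let U := I.finite_vertexSet.toFinset
  have hF : ∀ e, e ∈ F ↔ e ∈ I.graph.edgeSet := fun e => I.finite_edgeSet.mem_toFinset
  have hU : ∀ v, v ∈ U ↔ v ∈ I.graph.vertexSet := fun v => I.finite_vertexSet.mem_toFinset
  -- By symmetry the choice of endpoint does not matter.
  let w : E → ℝ := fun e => I.util (ends e).out.1 e
  have hutil : ∀ e ∈ F, ∀ v, I.util v e = if v ∈ ends e then w e else 0 := by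
    intro e he v
    have he' := (hF e).1 he
    split_ifs with hv
    · have hv' := (hends e he' v).1 hv
      have ho := (hends e he' _).1 (Sym2.out_fst_mem (ends e))
      obtain ⟨y, hy⟩ : ∃ y, I.graph.IsLink e v y := hv'
      rcases ho.eq_or_eq_of_isLink hy with h | h
      · simp only [w, h]
      · simp only [w, h]; exact hsymm e v y hy
    · exact I.util_eq_zero v e fun h => hv ((hends e he' v).2 h)
  obtain ⟨K, hKF, own, hown, hheavy, hcard, hefx⟩ :=
    FairDivision.exists_efx_allocation ends U (hV.imp fun v hv => (hU v).2 hv) F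
      (fun e he v hv => (hU v).2 ((hends e ((hF e).1 he) v).1 hv).vertex_mem) w a b hba hb
      (fun e he => hval e _ ((hends e ((hF e).1 he) _).1 (Sym2.out_fst_mem (ends e))))
  have hun : I.unallocated (fun i => K.filter (own · = i)) = ↑(F \ K) := by
    ext e
    simp [FairDivision.GoodsInstance.unallocated, hF]
  refine ⟨fun i => K.filter (own · = i), ⟨fun i j hij => ?_, fun i e he => ?_⟩,
    fun i _ j _ hij e he => ?_, ?_, ?_⟩
  · refine Finset.disjoint_left.2 fun e hi hj => hij ?_
    rw [← (Finset.mem_filter.1 hi).2, (Finset.mem_filter.1 hj).2]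
  · obtain ⟨heK, rfl⟩ := Finset.mem_filter.1 he
    exact (hends e ((hF e).1 (hKF heK)) _).1 (hown e heK)
  · obtain ⟨heK, hej⟩ := Finset.mem_filter.1 he
    convert hefx i j hij e heK hej using 1
    · refine Finset.sum_congr rfl fun f hf => hutil f ?_ i
      exact hKF (Finset.mem_filter.1 (Finset.mem_of_mem_erase hf)).1
    · refine Finset.sum_congr rfl fun f hf => ?_
      obtain ⟨hfK, rfl⟩ := Finset.mem_filter.1 hf
      rw [hutil f (hKF hfK), if_pos (hown f hfK)]
  · rw [hun]
    intro e he
    have he' := Finset.mem_coe.1 he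
    have heF := (hF e).1 (Finset.mem_sdiff.1 he').1
    exact ⟨_, (hends e heF _).1 (Sym2.out_fst_mem (ends e)), hheavy e he'⟩
  · rw [hun, Set.ncard_coe_finset, Set.ncard_eq_toFinset_card _ I.finite_vertexSet]
    exact hcard
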